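/- Let $X$ and $Y$ be real Banach spaces, $\bar x\in X$, $f:X\to Y$ continuous, and $F:X\rightrightarrows Y$ a set-valued mapping with closed graph such that $0\in f(\bar x)+F(\bar x)$. Write $\mathbb B(z,\rho)$ and $\mathbb B[z,\rho]$ for the open and closed balls, $\mathbb B_Z$ for the closed unit ball of $Z$, $\mathcal L(X,Y)$ for the space of bounded linear operators, $\operatorname{dom}S=\{x: S(x)\neq\emptyset\}$, and $S^{-1}(y)=\{x:\ y\in S(x)\}$; distances to sets take values in $[0,\infty]$ with $\operatorname{dist}(z,\emptyset)=\infty$. A mapping $G:X\rightrightarrows Y$ is *regular around* $(\bar x,\bar y)$ if $\bar y\in G(\bar x)$ and there are $\kappa>0$ and neighborhoods $U$ of $\bar x$ and $V$ of $\bar y$ with $\operatorname{dist}(x,G^{-1}(y))\le\kappa\operatorname{dist}(y,G(x))$ for all $(x,y)\in U\times V$. Its *modulus of surjection* $\operatorname{sur}G(\bar x,\bar y)\in[0,\infty]$ is the supremum ($\sup\emptyset=0$) of all $c>0$ for which there are $\varepsilon>0$ and neighborhoods $U$ of $\bar x$, $V$ of $\bar y$ such that $\mathbb B[y,ct]\subset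 G(\mathbb B[x,t])$ whenever $(x,y)\in U\times V$, $y\in G(x)$, $t\in(0,\varepsilon)$. The *measure of noncompactness* of $\mathcal A\subset\mathcal L(X,Y)$ is $$\chi(\mathcal A)=\inf\{\rho>0:\ \mathcal A\subset\mathcal F+\rho\,\mathbb B_{\mathcal L(X,Y)}\ \text{for some finite }\mathcal F\subset\mathcal A\}\in[0,\infty].$$ Let $\mathcal H:X\rightrightarrows\mathcal L(X,Y)$ satisfy $\bar x\in\operatorname{int}\operatorname{dom}\mathcal H$ and $\chi(\mathcal H(\bar x))<\infty$, and let $\mathcal H$ be upper semicontinuous at $\bar x$, in the sense that for every $\varepsilon>0$ one has $\mathcal H(x)\subset\mathcal H(\bar x)+\varepsilon\,\mathbb B_{\mathcal L(X,Y)}$ for all $x$ in some neighborhood of $\bar x$. Assume that for each $A\in\mathcal H(\bar x)$ the mapping $$G_A(x):=f(\bar x)+A(x-\bar x)+F(x),\qquad x\in X,$$ is regular around $(\bar x,0)$, and that $$\lim_{x\to\bar x,\ x\neq\bar x}\frac{\sup_{A\in\mathcal H(x)}\|f(x)-f(\bar x)-A(x-\bar x)\|}{\|x-\bar x\|}=0.$$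 Let $R_k:X\times X\rightrightarrows Y$, $k=0,1,2,\dots$, have closed graphs, with $(\bar x,\bar x)\in\operatorname{int}\bigl(\bigcap_k\operatorname{dom}R_k\bigr)$ and $0\in R_k(\bar x,\bar x)$ for each $k$. Assume that there are positive constants $a,\gamma,\ell$ with $$\chi(\mathcal H(\bar x))+\ell+\gamma<\inf_{A\in\mathcal H(\bar x)}\operatorname{sur}G_A(\bar x,0),$$ $$\limsup_{x\to\bar x,\ x\neq\bar x}\frac{\sup_{k}\operatorname{dist}(0,R_k(x,\bar x))}{\|x-\bar x\|}<\gamma,$$ and, for all $x,u,u'\in\mathbb B(\bar x,a)$ and all $k$, $$R_k(x,u)\cap\mathbb B(0,a)\subset R_k(x,u')+\ell\|u-u'\|\,\mathbb B_Y.$$ Then there exist $t\in(0,1)$ and $r>0$ such that for any starting point $x_0\in\mathbb B(\bar x,r)$, and whatever rule is used to choose $A_k\in\mathcal H(x_k)$ from $k$ and $x_k$, there is a sequence $(x_k)$ in $\mathbb B(\bar x,r)$, starting at $x_0$, such that for every $k\ge 0$ one has $A_k\in\mathcal H(x_k)$, $$\bigl(f(x_k)+A_k(x_{k+1}-x_k)+F(x_{k+1})\bigr)\cap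 R_k(x_k,x_{k+1})\neq\emptyset\quad\text{and}\quad\|x_{k+1}-\bar x\|\le t\,\|x_k-\bar x\|;$$ in particular $(x_k)$ converges to $\bar x$ (q-linearly). -/

import Mathlib

open Set Filter Topology
open scoped ENNReal Pointwise

/- A set-valued mapping `F : X ⇉ Y` is represented by a function `F : X → Set Y`. -/

namespace SetMap

/-- The domain of a set-valued mapping. -/
def dom {X Y : Type*} (F : X → Set Y) : Set X := {x | (F x).Nonempty}

/-- The graph of a set-valued mapping. -/
def graph {X Y : Type*} (F : X → Set Y) : Set (X × Y) := {p | p.2 ∈ F p.1}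

/-- The inverse of a set-valued mapping. -/
def inv {X Y : Type*} (F : X → Set Y) : Y → Set X := fun y => {x | y ∈ F x}

/-- Metric regularity of `F` around `(xb, yb)`. The distance to a set is extended-real valued,
so that the distance to the empty set is `∞`. -/
def IsRegularAround {X Y : Type*} [MetricSpace X] [MetricSpace Y]
    (F : X → Set Y) (xb : X) (yb : Y) : Prop :=
  yb ∈ F xb ∧ ∃ κ : ℝ, 0 < κ ∧ ∃ U ∈ 𝓝 xb, ∃ V ∈ 𝓝 yb, ∀ x ∈ U, ∀ y ∈ V,
    Metric.infEDist x (inv F y) ≤ ENNReal.ofReal κ * Metric.infEDist y (F x)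

/-- `F` is open with a linear rate around `(xb, yb)` with the constant `c`, apart from the
requirement `yb ∈ F xb`. -/
def IsOpenWithRate {X Y : Type*} [MetricSpace X] [MetricSpace Y]
    (F : X → Set Y) (xb : X) (yb : Y) (c : ℝ) : Prop :=
  ∃ ε : ℝ, 0 < ε ∧ ∃ U ∈ 𝓝 xb, ∃ V ∈ 𝓝 yb, ∀ x ∈ U, ∀ y ∈ V, y ∈ F x → ∀ t ∈ Ioo 0 ε,
    Metric.closedBall y (c * t) ⊆ ⋃ x' ∈ Metric.closedBall x t, F x'

/-- The modulus of surjection of `F` around `(xb, yb)`: the supremum in `[0, ∞]` of all `c > 0`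
such that `F` is open with the linear rate `c` around `(xb, yb)` (with `sup ∅ = 0`). -/
noncomputable def sur {X Y : Type*} [MetricSpace X] [MetricSpace Y]
    (F : X → Set Y) (xb : X) (yb : Y) : ℝ≥0∞ :=
  ⨆ (c : ℝ) (_ : 0 < c) (_ : IsOpenWithRate F xb yb c), ENNReal.ofReal c

/-- Upper semicontinuity at `xb` of a set-valued mapping into a normed space: for every `ε > 0`,
`F x ⊆ F xb + ε 𝔹` for all `x` close to `xb`. -/
def IsUpperSemicontinuousAt {X Z : Type*} [TopologicalSpace X] [SeminormedAddCommGroup Z]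
    (F : X → Set Z) (xb : X) : Prop :=
  ∀ ε : ℝ, 0 < ε → ∀ᶠ x in 𝓝 xb, F x ⊆ F xb + Metric.closedBall (0 : Z) ε

/-- Upper semicontinuity in the sense of open sets implies the `ε`-version above, so a theorem
which assumes the latter covers both. -/
theorem isUpperSemicontinuousAt_of_upperHemicontinuousAt {X Z : Type*} [TopologicalSpace X]
    [SeminormedAddCommGroup Z] {F : X → Set Z} {xb : X} (h : UpperHemicontinuousAt F xb) :
    IsUpperSemicontinuousAt F xb := by
  intro ε hε
  have h1 := upperHemicontinuousAt_iff.1 h _ (Metric.thickening_mem_nhdsSet (F xb) hε)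
  filter_upwards [h1] with x hx z hz
  obtain ⟨w, hw, hzw⟩ := Metric.mem_thickening_iff.1 (subset_of_mem_nhdsSet hx hz)
  refine Set.mem_add.2 ⟨w, hw, z - w, ?_, by abel⟩
  rw [mem_closedBall_zero_iff, ← dist_eq_norm]
  exact hzw.le

/-- The measure of noncompactness `χ(𝒜)` of a subset of a normed space: the infimum in `[0, ∞]`
of all `r > 0` such that `𝒜 ⊆ 𝓕 + r 𝔹` for some finite `𝓕 ⊆ 𝒜`. -/
noncomputable def noncompactness {Z : Type*} [SeminormedAddCommGroup Z] (𝒜 : Set Z) : ℝ≥0∞ :=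
  ⨅ (r : ℝ) (_ : 0 < r)
    (_ : ∃ 𝓕 : Set Z, 𝓕.Finite ∧ 𝓕 ⊆ 𝒜 ∧ 𝒜 ⊆ 𝓕 + Metric.closedBall (0 : Z) r),
    ENNReal.ofReal r

/-- The partial linearization `G_A(x) = f(xb) + A (x - xb) + F(x)`. -/
def partialLin {X Y : Type*} [NormedAddCommGroup X] [NormedSpace ℝ X]
    [NormedAddCommGroup Y] [NormedSpace ℝ Y]
    (f : X → Y) (F : X → Set Y) (xb : X) (A : X →L[ℝ] Y) : X → Set Y :=
  fun x => {f xb + A (x - xb)} + F x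

/-- `x'` is an admissible next iterate from `x` for the operator `A` and the inexactness mapping
`R : X × X ⇉ Y`: the sets `f(x) + A (x' - x) + F(x')` and `R(x, x')` have a common point. -/
def IsNewtonStep {X Y : Type*} [NormedAddCommGroup X] [NormedSpace ℝ X]
    [NormedAddCommGroup Y] [NormedSpace ℝ Y]
    (f : X → Y) (F : X → Set Y) (R : X × X → Set Y) (A : X →L[ℝ] Y) (x x' : X) : Prop :=
  (({f x + A (x' - x)} + F x') ∩ R (x, x')).Nonempty

end SetMap

namespace SetMap

/-! With `e = f x - f xb - A (x - xb)`, one has `f x + A (u - x) = f xb + B (u - xb) + e + (A - B)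
(u - xb)`. So a Newton step from `x` is a point `u` where the partial linearization at `B` meets `R
(x, u)` shifted by `-(e + (A - B) (u - xb))`. The former is open with rate `c`; the latter has the
Aubin property with constant `ρ + l < c` when `‖A - B‖ ≤ ρ`, and at `xb` it has a point of norm at
most `(γ + η) * ‖x - xb‖`. Hence `exists_inter_nonempty_of_open_of_aubin` gives a step with
contraction factor `(γ + η) / (c - (ρ + l))`. Finite `χ` confines `B` to a finite net of `H xb`, so
a single radius of openness serves every `A ∈ H x` with `x` near `xb`. -/

/-! ### Coincidence points of open and Aubin mappings. -/

theorem exists_seq_of_forall_exists {α : Type*} {P : ℕ → α → Prop} {Q : ℕ → α → α → Prop}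
    (a : α) (ha : P 0 a) (h : ∀ n x, P n x → ∃ y, P (n + 1) y ∧ Q n x y) :
    ∃ u : ℕ → α, u 0 = a ∧ (∀ n, P n (u n)) ∧ ∀ n, Q n (u n) (u (n + 1)) := by
  choose! g hg using h
  have hP : ∀ n, P n (Nat.rec a g n) := by
    intro n
    induction n with
    | zero => exact ha
    | succ n ih => exact (hg n _ ih).1
  exact ⟨fun n => Nat.rec a g n, rfl, hP, fun n => (hg n _ (hP n)).2⟩

/-- Coincidence theorem of Lyusternik–Graves type: a mapping `G` which is open with the linear
rate `c` near `(xb, 0)` and a mapping `S` with the Aubin property with a constant `L < c` have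
overlapping values near `xb`, as soon as `S xb` has a point close to `0`. -/
theorem exists_inter_nonempty_of_open_of_aubin
    {X Y : Type*} [NormedAddCommGroup X] [CompleteSpace X]
    [NormedAddCommGroup Y] [CompleteSpace Y]
    {G S : X → Set Y} (hG : IsClosed (graph G)) (hS : IsClosed (graph S))
    {xb : X} {c L δ τ : ℝ} (hL : 0 ≤ L) (hLc : L < c) (hτ : 0 ≤ τ) (hτδ : τ < δ)
    (hcτ : c * τ < δ)
    (hopen : ∀ u ∈ Metric.ball xb δ, ∀ v ∈ Metric.ball (0 : Y) δ, v ∈ G u → ∀ t ∈ Ioo 0 δ,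
      Metric.closedBall v (c * t) ⊆ ⋃ u' ∈ Metric.closedBall u t, G u')
    (haubin : ∀ u ∈ Metric.ball xb δ, ∀ u' ∈ Metric.ball xb δ,
      S u ∩ Metric.ball 0 δ ⊆ S u' + Metric.closedBall 0 (L * ‖u - u'‖))
    (hG0 : (0 : Y) ∈ G xb) {s₀ : Y} (hs₀ : s₀ ∈ S xb) (hs₀τ : ‖s₀‖ ≤ τ * (c - L)) :
    ∃ u, ‖u - xb‖ ≤ τ ∧ (G u ∩ S u).Nonempty := by
  have hc : 0 < c := hL.trans_lt hLc
  set θ : ℝ := L / c with hθ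
  have hθ0 : 0 ≤ θ := by positivity
  have hθ1 : θ < 1 := (div_lt_one hc).2 hLc
  have hLθ : L = θ * c := by rw [hθ]; field_simp
  -- Triples `(u, v, s)` with `v ∈ G u`, `s ∈ S u`: openness moves `u` until `G` attains `s`, then
  -- the Aubin property replaces `s`, so the gap `‖s - v‖` shrinks by `θ = L / c`. The factors `1 -
  -- θ ^ n` are summed geometric series and keep all points in the `δ`-balls.
  obtain ⟨z, -, hz, hzz⟩ := exists_seq_of_forall_exists
    (P := fun n (p : X × Y × Y) => p.2.1 ∈ G p.1 ∧ p.2.2 ∈ S p.1 ∧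
      ‖p.1 - xb‖ ≤ τ * (1 - θ ^ n) ∧ ‖p.2.1‖ ≤ c * τ * (1 - θ ^ n) ∧
      ‖p.2.2 - p.2.1‖ ≤ c * τ * (1 - θ) * θ ^ n)
    (Q := fun n p q => q.2.1 = p.2.2 ∧ ‖q.1 - p.1‖ ≤ τ * (1 - θ) * θ ^ n)
    (xb, 0, s₀) ⟨hG0, hs₀, by simp, by simp, by
      simp only [sub_zero, pow_zero, mul_one]
      calc ‖s₀‖ ≤ τ * (c - L) := hs₀τ
        _ = c * τ * (1 - θ) := by rw [hLθ]; ring⟩ (by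
    rintro n ⟨u, v, s⟩ ⟨hv, hs, hu, hvn, hd⟩
    simp only at hv hs hu hvn hd ⊢
    have hpow0 : 0 ≤ θ ^ n := by positivity
    have hpow1 : θ ^ n ≤ 1 := pow_le_one₀ hθ0 hθ1.le
    have hτθ : 0 ≤ τ * θ ^ n := by positivity
    have hcτθ : 0 ≤ c * τ * θ ^ n := by positivity
    have hcτθ' : 0 ≤ c * τ * θ ^ n * θ := by positivity
    have hτθ' : 0 ≤ τ * θ ^ n * θ := by positivity
    have hub : u ∈ Metric.ball xb δ := by
      rw [mem_ball_iff_norm]; linarith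
    have hvb : v ∈ Metric.ball (0 : Y) δ := by
      rw [mem_ball_zero_iff]; linarith
    have hsn : ‖s‖ ≤ c * τ * (1 - θ ^ n * θ) := by
      have := norm_add_le v (s - v)
      rw [add_sub_cancel] at this
      linarith
    have hsb : s ∈ Metric.ball (0 : Y) δ := by
      rw [mem_ball_zero_iff]; linarith
    have hstep : ∃ u', s ∈ G u' ∧ c * ‖u' - u‖ ≤ ‖s - v‖ := by
      -- Openness is available only for radii `t > 0`, so a zero gap is treated apart.
      rcases eq_or_ne s v with rfl | hne
      · exact ⟨u, hv, by simp⟩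
      · have hpos : 0 < ‖s - v‖ := norm_pos_iff.2 (sub_ne_zero.2 hne)
        have ht : ‖s - v‖ / c ∈ Ioo 0 δ := by
          refine ⟨by positivity, ?_⟩
          have : ‖s - v‖ / c ≤ τ := by
            rw [div_le_iff₀ hc]
            have : c * τ * θ ^ n ≤ c * τ := mul_le_of_le_one_right (by positivity) hpow1
            linarith
          linarith
        have hmem : s ∈ Metric.closedBall v (c * (‖s - v‖ / c)) := by
          rw [mul_div_cancel₀ _ hc.ne', mem_closedBall_iff_norm]
        obtain ⟨u', hu', hsu'⟩ := mem_iUnion₂.1 (hopen u hub v hvb hv _ ht hmem)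
        refine ⟨u', hsu', ?_⟩
        rw [mem_closedBall_iff_norm, le_div_iff₀ hc] at hu'
        linarith
    obtain ⟨u', hsu', hu'⟩ := hstep
    have hu'n : ‖u' - u‖ ≤ τ * (1 - θ) * θ ^ n := by
      refine le_of_mul_le_mul_left ?_ hc
      linarith
    have hu'xb : ‖u' - xb‖ ≤ τ * (1 - θ ^ n * θ) := by
      have := norm_add_le (u' - u) (u - xb)
      rw [sub_add_sub_cancel] at this
      linarith
    have hu'b : u' ∈ Metric.ball xb δ := by
      rw [mem_ball_iff_norm]; linarith
    obtain ⟨s', hs', w, hw, hsw⟩ := Set.mem_add.1 (haubin u hub u' hu'b ⟨hs, hsb⟩)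
    rw [mem_closedBall_zero_iff, norm_sub_rev] at hw
    refine ⟨(u', s, s'), ⟨hsu', hs', by rwa [pow_succ], by rwa [pow_succ], ?_⟩, rfl, hu'n⟩
    have hw' : s' - s = -w := by rw [← hsw]; abel
    rw [hw', norm_neg]
    calc ‖w‖ ≤ L * ‖u' - u‖ := hw
      _ ≤ L * (τ * (1 - θ) * θ ^ n) := by gcongr
      _ = c * τ * (1 - θ) * θ ^ (n + 1) := by rw [hLθ]; ring)
  have hu : CauchySeq fun n => (z n).1 := by
    refine cauchySeq_of_le_geometric θ (τ * (1 - θ)) hθ1 fun n => ?_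
    rw [dist_eq_norm, norm_sub_rev]
    exact (hzz n).2
  have hv : CauchySeq fun n => (z n).2.1 := by
    refine cauchySeq_of_le_geometric θ (c * τ * (1 - θ)) hθ1 fun n => ?_
    rw [dist_eq_norm, norm_sub_rev, (hzz n).1]
    exact (hz n).2.2.2.2
  obtain ⟨u, hu⟩ := cauchySeq_tendsto_of_complete hu
  obtain ⟨v, hv⟩ := cauchySeq_tendsto_of_complete hv
  -- Each `s` is the next `v`, so both sequences share a limit.
  have hs : Tendsto (fun n => (z n).2.2) atTop (𝓝 v) :=
    ((tendsto_add_atTop_iff_nat 1).2 hv).congr fun n => (hzz n).1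
  refine ⟨u, ?_, v, ?_, ?_⟩
  · refine le_of_tendsto (hu.sub_const xb).norm (Eventually.of_forall fun n => ?_)
    refine (hz n).2.2.1.trans (mul_le_of_le_one_right hτ ?_)
    linarith [pow_nonneg hθ0 n]
  · exact hG.mem_of_tendsto (hu.prodMk_nhds hv) (Eventually.of_forall fun n => (hz n).1)
  · exact hS.mem_of_tendsto (hu.prodMk_nhds hs) (Eventually.of_forall fun n => (hz n).2.1)

/-! ### Closed graphs, rates of openness, finite nets. -/

theorem isClosed_graph_singleton_add {X Y : Type*} [TopologicalSpace X]
    [NormedAddCommGroup Y] {F : X → Set Y} (hF : IsClosed (graph F))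
    {g : X → Y} (hg : Continuous g) : IsClosed (graph fun x => {g x} + F x) := by
  have h : (graph fun x => {g x} + F x) = (fun p : X × Y => (p.1, -g p.1 + p.2)) ⁻¹' graph F := by
    ext ⟨x, y⟩
    simp [graph]
  rw [h]
  exact hF.preimage (by fun_prop)

/-- Stated for all small `δ`, so that finitely many operators can share one radius. -/
theorem IsOpenWithRate.eventually {X Y : Type*} [MetricSpace X] [MetricSpace Y]
    {F : X → Set Y} {xb : X} {yb : Y} {c c' : ℝ} (h : IsOpenWithRate F xb yb c) (hc : c' ≤ c) :
    ∀ᶠ δ : ℝ in 𝓝[>] 0, ∀ u ∈ Metric.ball xb δ, ∀ v ∈ Metric.ball yb δ, v ∈ F u →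
      ∀ t ∈ Ioo 0 δ, Metric.closedBall v (c' * t) ⊆ ⋃ u' ∈ Metric.closedBall u t, F u' := by
  obtain ⟨ε, hε, U, hU, V, hV, h⟩ := h
  obtain ⟨ε₁, hε₁, hU⟩ := Metric.mem_nhds_iff.1 hU
  obtain ⟨ε₂, hε₂, hV⟩ := Metric.mem_nhds_iff.1 hV
  filter_upwards [Ioo_mem_nhdsGT hε, Ioo_mem_nhdsGT hε₁, Ioo_mem_nhdsGT hε₂]
    with δ h0 h1 h2 u hu v hv hvu t ht
  refine Subset.trans (Metric.closedBall_subset_closedBall ?_)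
    (h u (hU (Metric.ball_subset_ball h1.2.le hu)) v (hV (Metric.ball_subset_ball h2.2.le hv))
      hvu t ⟨ht.1, ht.2.trans h0.2⟩)
  exact mul_le_mul_of_nonneg_right hc ht.1.le

theorem exists_isOpenWithRate_of_lt_sur {X Y : Type*} [MetricSpace X] [MetricSpace Y]
    {F : X → Set Y} {xb : X} {yb : Y} {c : ℝ} (h : ENNReal.ofReal c < sur F xb yb) :
    ∃ c', c ≤ c' ∧ IsOpenWithRate F xb yb c' := by
  simp only [sur, lt_iSup_iff] at h
  obtain ⟨c', -, hF, hc⟩ := h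
  refine ⟨c', ?_, hF⟩
  by_contra! hlt
  exact hc.not_ge (ENNReal.ofReal_le_ofReal hlt.le)

theorem exists_finite_cover_of_noncompactness_lt {Z : Type*} [SeminormedAddCommGroup Z]
    {𝒜 : Set Z} {ρ : ℝ} (h : noncompactness 𝒜 < ENNReal.ofReal ρ) :
    ∃ 𝓕 : Set Z, 𝓕.Finite ∧ 𝓕 ⊆ 𝒜 ∧ 𝒜 ⊆ 𝓕 + Metric.closedBall (0 : Z) ρ := by
  simp only [noncompactness, iInf_lt_iff] at h
  obtain ⟨r, hr, ⟨𝓕, h1, h2, h3⟩, hrρ⟩ := h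
  refine ⟨𝓕, h1, h2, h3.trans (Set.add_subset_add_left (Metric.closedBall_subset_closedBall ?_))⟩
  exact ((ENNReal.ofReal_lt_ofReal_iff_of_nonneg hr.le).1 hrρ).le

/-! ### A single Newton step. -/

/-- One step of the perturbed Newton iteration, for a linearization `A` within `ρ` of an operator
`B` whose partial linearization is open with the linear rate `c`. -/
theorem exists_isNewtonStep {X Y : Type*} [NormedAddCommGroup X] [NormedSpace ℝ X]
    [CompleteSpace X] [NormedAddCommGroup Y] [NormedSpace ℝ Y] [CompleteSpace Y]
    {xb x : X} {f : X → Y} {F : X → Set Y} (hF : IsClosed (graph F))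
    (hsol : (0 : Y) ∈ ({f xb} : Set Y) + F xb) {R : X × X → Set Y} (hR : IsClosed (graph R))
    {A B : X →L[ℝ] Y} {a c γ l ρ η δ t : ℝ} (hl : 0 ≤ l) (hδa : (1 + η + ρ) * δ ≤ a)
    (hδa' : δ ≤ a) (hη : 0 ≤ η) (ht0 : 0 ≤ t) (ht1 : t < 1) (hLc : ρ + l < c)
    (ht : γ + η ≤ t * (c - (ρ + l))) (hδ : 0 < δ)
    (hopen : ∀ u ∈ Metric.ball xb δ, ∀ v ∈ Metric.ball (0 : Y) δ, v ∈ partialLin f F xb B u →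
      ∀ t ∈ Ioo 0 δ, Metric.closedBall v (c * t) ⊆
        ⋃ u' ∈ Metric.closedBall u t, partialLin f F xb B u')
    (hAB : ‖A - B‖ ≤ ρ) (hxδ : ‖x - xb‖ < δ) (hxc : c * ‖x - xb‖ < δ)
    (hlin : ‖f x - f xb - A (x - xb)‖ ≤ η * ‖x - xb‖)
    {r₀ : Y} (hr₀ : r₀ ∈ R (x, xb)) (hr₀x : ‖r₀‖ ≤ γ * ‖x - xb‖)
    (haubin : ∀ u ∈ Metric.ball xb a, ∀ u' ∈ Metric.ball xb a,
      R (x, u) ∩ Metric.ball 0 a ⊆ R (x, u') + Metric.closedBall 0 (l * ‖u - u'‖)) :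
    ∃ x', IsNewtonStep f F R A x x' ∧ ‖x' - xb‖ ≤ t * ‖x - xb‖ := by
  have hρ : 0 ≤ ρ := (norm_nonneg _).trans hAB
  set e : Y := f x - f xb - A (x - xb) with he
  set p : X → Y := fun u => -(e + (A - B) (u - xb)) with hp
  have hpc : Continuous p := by fun_prop
  have hpL : ∀ u u', ‖p u - p u'‖ ≤ ρ * ‖u - u'‖ := by
    intro u u'
    have : p u - p u' = -((A - B) (u - u')) := by
      simp only [hp, map_sub]; abel
    rw [this, norm_neg]
    exact (A - B).le_of_opNorm_le hAB _
  have hpn : ∀ u, ‖p u‖ ≤ η * ‖x - xb‖ + ρ * ‖u - xb‖ := by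
    intro u
    rw [hp, norm_neg]
    exact (norm_add_le _ _).trans (add_le_add hlin ((A - B).le_of_opNorm_le hAB _))
  have hRx : IsClosed (graph fun u => R (x, u)) :=
    hR.preimage (f := fun q : X × Y => ((x, q.1), q.2)) (by fun_prop)
  have hs₀ : p xb + r₀ ∈ ({p xb} : Set Y) + R (x, xb) := Set.add_mem_add rfl hr₀
  have hnn : 0 ≤ ‖x - xb‖ := norm_nonneg _
  have haub : ∀ u ∈ Metric.ball xb δ, ∀ u' ∈ Metric.ball xb δ,
      ({p u} + R (x, u)) ∩ Metric.ball 0 δ ⊆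
        ({p u'} + R (x, u')) + Metric.closedBall 0 ((ρ + l) * ‖u - u'‖) := by
    rintro u hu u' hu' s ⟨hs, hsδ⟩
    simp only [singleton_add, mem_image] at hs
    obtain ⟨w, hw, rfl⟩ := hs
    rw [mem_ball_zero_iff] at hsδ
    have huδ : ‖u - xb‖ < δ := mem_ball_iff_norm.1 hu
    -- Undoing the shift costs at most `(η + ρ) * δ`, whence the requirement `(1 + η + ρ) * δ ≤ a`.
    have hwa : w ∈ Metric.ball (0 : Y) a := by
      rw [mem_ball_zero_iff]
      have h1 := norm_sub_le (p u + w) (p u)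
      rw [add_sub_cancel_left] at h1
      have h2 := hpn u
      have h3 : η * ‖x - xb‖ ≤ η * δ := by gcongr
      have h4 : ρ * ‖u - xb‖ ≤ ρ * δ := by gcongr
      linarith
    obtain ⟨w', hw', b, hb, hwb⟩ := Set.mem_add.1 (haubin u (Metric.ball_subset_ball hδa' hu) u'
      (Metric.ball_subset_ball hδa' hu') ⟨hw, hwa⟩)
    rw [mem_closedBall_zero_iff] at hb
    refine Set.mem_add.2 ⟨p u' + w', Set.add_mem_add rfl hw', p u - p u' + b, ?_, ?_⟩
    · rw [mem_closedBall_zero_iff]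
      linarith [norm_add_le (p u - p u') b, hpL u u']
    · rw [← hwb]; abel
  have hs₀n : ‖p xb + r₀‖ ≤ t * ‖x - xb‖ * (c - (ρ + l)) := by
    have h1 := norm_add_le (p xb) r₀
    have h2 := hpn xb
    rw [sub_self, norm_zero, mul_zero, add_zero] at h2
    calc ‖p xb + r₀‖ ≤ (γ + η) * ‖x - xb‖ := by linarith
      _ ≤ t * (c - (ρ + l)) * ‖x - xb‖ := by gcongr
      _ = t * ‖x - xb‖ * (c - (ρ + l)) := by ring
  obtain ⟨x', hx', y, hyG, hyS⟩ := exists_inter_nonempty_of_open_of_aubin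
    (G := partialLin f F xb B) (S := fun u => {p u} + R (x, u)) (τ := t * ‖x - xb‖)
    (isClosed_graph_singleton_add hF (by fun_prop)) (isClosed_graph_singleton_add hRx hpc)
    (by positivity) hLc (by positivity)
    ((mul_le_of_le_one_left hnn ht1.le).trans_lt hxδ)
    (by nlinarith [mul_le_of_le_one_left hnn ht1.le]) hopen haub
    (by simpa [partialLin] using hsol) hs₀ hs₀n
  refine ⟨x', ⟨y - p x', ?_, ?_⟩, hx'⟩
  · simp only [partialLin, singleton_add, mem_image] at hyG ⊢
    obtain ⟨w, hw, rfl⟩ := hyG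
    refine ⟨w, hw, ?_⟩
    simp only [hp, he, sub_apply, map_sub]
    abel
  · simp only [singleton_add, mem_image] at hyS
    obtain ⟨w, hw, rfl⟩ := hyS
    simpa using hw

end SetMap

/-! ### Choice of constants and the iteration. -/

theorem mainTheorem1
    {X Y : Type*} [NormedAddCommGroup X] [NormedSpace ℝ X] [CompleteSpace X]
    [NormedAddCommGroup Y] [NormedSpace ℝ Y] [CompleteSpace Y]
    (xb : X) (f : X → Y) (hf : Continuous f)
    (F : X → Set Y) (hF : IsClosed (SetMap.graph F))
    (hsol : (0 : Y) ∈ ({f xb} : Set Y) + F xb)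
    (H : X → Set (X →L[ℝ] Y))
    (hH_usc : SetMap.IsUpperSemicontinuousAt H xb)
    (hH_dom : xb ∈ interior (SetMap.dom H))
    (hH_fin : SetMap.noncompactness (H xb) < ∞)
    (hreg : ∀ A ∈ H xb, SetMap.IsRegularAround (SetMap.partialLin f F xb A) xb 0)
    (hsemi : Tendsto
      (fun x => (⨆ A ∈ H x, ENNReal.ofReal ‖f x - f xb - A (x - xb)‖) /
        ENNReal.ofReal ‖x - xb‖) (𝓝[≠] xb) (𝓝 0))
    (R : ℕ → X × X → Set Y) (hR_closed : ∀ k, IsClosed (SetMap.graph (R k)))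
    (hR_dom : (xb, xb) ∈ interior (⋂ k, SetMap.dom (R k)))
    (hR_zero : ∀ k, (0 : Y) ∈ R k (xb, xb))
    (a γ l : ℝ) (ha : 0 < a) (hγ : 0 < γ) (hl : 0 < l)
    (hconst : SetMap.noncompactness (H xb) + ENNReal.ofReal l + ENNReal.ofReal γ <
      ⨅ A ∈ H xb, SetMap.sur (SetMap.partialLin f F xb A) xb 0)
    (hR_calm : limsup
      (fun x => (⨆ k, Metric.infEDist (0 : Y) (R k (x, xb))) / ENNReal.ofReal ‖x - xb‖)
      (𝓝[≠] xb) < ENNReal.ofReal γ)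
    (hR_aubin : ∀ x ∈ Metric.ball xb a, ∀ u ∈ Metric.ball xb a, ∀ u' ∈ Metric.ball xb a, ∀ k,
      R k (x, u) ∩ Metric.ball 0 a ⊆ R k (x, u') + Metric.closedBall 0 (l * ‖u - u'‖)) :
    ∃ t ∈ Ioo (0 : ℝ) 1, ∃ r : ℝ, 0 < r ∧
      -- `σ` is a rule which chooses `A_k ∈ H(x_k)` once `k` and `x_k` are known
      ∀ σ : ℕ → X → (X →L[ℝ] Y), (∀ k, ∀ x ∈ SetMap.dom H, σ k x ∈ H x) →
        ∀ x₀ ∈ Metric.ball xb r, ∃ x : ℕ → X, x 0 = x₀ ∧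
          (∀ k, x k ∈ Metric.ball xb r ∧
            σ k (x k) ∈ H (x k) ∧
            SetMap.IsNewtonStep f F (R k) (σ k (x k)) (x k) (x (k + 1)) ∧
            ‖x (k + 1) - xb‖ ≤ t * ‖x k - xb‖) ∧
          Tendsto x atTop (𝓝 xb) := by
  obtain ⟨c, hc1, hc2⟩ := ENNReal.lt_iff_exists_nnreal_btwn.1 hconst
  set χ : ℝ := (SetMap.noncompactness (H xb)).toReal with hχ
  have hχ0 : 0 ≤ χ := ENNReal.toReal_nonneg
  have hχe : SetMap.noncompactness (H xb) = ENNReal.ofReal χ := (ENNReal.ofReal_toReal hH_fin.ne).symm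
  have hc : χ + l + γ < c := by
    rw [hχe, ← ENNReal.ofReal_add hχ0 hl.le, ← ENNReal.ofReal_add (by positivity) hγ.le,
      ← ENNReal.ofReal_coe_nnreal] at hc1
    exact (ENNReal.ofReal_lt_ofReal_iff_of_nonneg (by positivity)).1 hc1
  -- The slack is cut in four: one `η` for the net, one for semicontinuity, one for the
  -- linearization error. The last leaves `c - (ρ + l) = γ + 2 * η > γ + η`, so `t < 1`.
  obtain ⟨η, hη, hηc⟩ : ∃ η : ℝ, 0 < η ∧ χ + l + γ + 4 * η = c :=
    ⟨((c : ℝ) - (χ + l + γ)) / 4, by linarith, by ring⟩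
  obtain ⟨𝓕, h𝓕fin, h𝓕H, h𝓕⟩ := SetMap.exists_finite_cover_of_noncompactness_lt
    (𝒜 := H xb) (ρ := χ + η) (by
      rw [hχe]; exact (ENNReal.ofReal_lt_ofReal_iff_of_nonneg hχ0).2 (by linarith))
  have hopen : ∀ᶠ δ : ℝ in 𝓝[>] 0, ∀ B ∈ 𝓕, ∀ u ∈ Metric.ball xb δ, ∀ v ∈ Metric.ball (0 : Y) δ,
      v ∈ SetMap.partialLin f F xb B u → ∀ t ∈ Ioo 0 δ, Metric.closedBall v (c * t) ⊆
        ⋃ u' ∈ Metric.closedBall u t, SetMap.partialLin f F xb B u' := by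
    rw [eventually_all_finite h𝓕fin]
    intro B hB
    obtain ⟨c', hcc', hB'⟩ := SetMap.exists_isOpenWithRate_of_lt_sur (c := c) (by
      rw [ENNReal.ofReal_coe_nnreal]
      exact hc2.trans_le (iInf₂_le B (h𝓕H hB)))
    exact hB'.eventually hcc'
  set ρ : ℝ := χ + η + η with hρ
  have hK : 0 < 1 + η + ρ := by positivity
  obtain ⟨δ, hδopen, hδ, hδa⟩ := (hopen.and (Ioo_mem_nhdsGT (div_pos ha hK))).exists
  have hδa : (1 + η + ρ) * δ ≤ a := by
    rw [lt_div_iff₀ hK] at hδa; linarith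
  have hδa' : δ ≤ a := by
    have : 0 ≤ (η + ρ) * δ := by positivity
    linarith
  have hcL : 0 < c - (ρ + l) := by linarith
  set t : ℝ := (γ + η) / (c - (ρ + l)) with ht
  have ht0 : 0 < t := by positivity
  have ht1 : t < 1 := (div_lt_one hcL).2 (by linarith)
  have htm : γ + η ≤ t * (c - (ρ + l)) := (div_mul_cancel₀ _ hcL.ne').ge
  have hev : ∀ᶠ x in 𝓝 xb, x ∈ SetMap.dom H ∧ ‖x - xb‖ < δ ∧ c * ‖x - xb‖ < δ ∧
      H x ⊆ H xb + Metric.closedBall 0 η ∧ (x ≠ xb →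
        (⨆ A ∈ H x, ENNReal.ofReal ‖f x - f xb - A (x - xb)‖) / ENNReal.ofReal ‖x - xb‖ <
          ENNReal.ofReal η ∧
        (⨆ k, Metric.infEDist (0 : Y) (R k (x, xb))) / ENNReal.ofReal ‖x - xb‖ <
          ENNReal.ofReal γ) := by
    have h1 : Tendsto (fun x => ‖x - xb‖) (𝓝 xb) (𝓝 0) := tendsto_norm_sub_self xb
    have h2 := h1.const_mul (c : ℝ)
    rw [mul_zero] at h2
    have h3 := hsemi.eventually_lt_const (ENNReal.ofReal_pos.2 hη)
    have h4 := eventually_lt_of_limsup_lt hR_calm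
    filter_upwards [mem_interior_iff_mem_nhds.1 hH_dom, h1.eventually_lt_const hδ,
      h2.eventually_lt_const hδ, hH_usc η hη, eventually_nhdsWithin_iff.1 (h3.and h4)]
      with x g1 g2 g3 g4 g5
    exact ⟨g1, g2, g3, g4, g5⟩
  obtain ⟨r, hr, hball⟩ := Metric.eventually_nhds_iff_ball.1 hev
  refine ⟨t, ⟨ht0, ht1⟩, r, hr, fun σ hσ x₀ hx₀ => ?_⟩
  have hstep : ∀ k, ∀ x ∈ Metric.ball xb r, ∃ x' ∈ Metric.ball xb r, σ k x ∈ H x ∧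
      SetMap.IsNewtonStep f F (R k) (σ k x) x x' ∧ ‖x' - xb‖ ≤ t * ‖x - xb‖ := by
    intro k x hx
    obtain ⟨hdom, hxδ, hxc, hHx, hne⟩ := hball x hx
    have hA := hσ k x hdom
    suffices h : ∃ x', SetMap.IsNewtonStep f F (R k) (σ k x) x x' ∧ ‖x' - xb‖ ≤ t * ‖x - xb‖ by
      obtain ⟨x', h1, h2⟩ := h
      refine ⟨x', ?_, hA, h1, h2⟩
      rw [mem_ball_iff_norm] at hx ⊢
      exact (h2.trans (mul_le_of_le_one_left (norm_nonneg _) ht1.le)).trans_lt hx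
    -- At `xb` the difference quotients give no information, but staying there is an exact step.
    rcases eq_or_ne x xb with rfl | hxne
    · exact ⟨x, ⟨0, by simpa using hsol, hR_zero k⟩, by simp⟩
    obtain ⟨hlin, hres⟩ := hne hxne
    have hpos : 0 < ‖x - xb‖ := norm_pos_iff.2 (sub_ne_zero.2 hxne)
    have hpos' := ENNReal.ofReal_pos.2 hpos
    rw [ENNReal.div_lt_iff (.inl hpos'.ne') (.inl ENNReal.ofReal_ne_top),
      ← ENNReal.ofReal_mul hη.le] at hlin
    rw [ENNReal.div_lt_iff (.inl hpos'.ne') (.inl ENNReal.ofReal_ne_top),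
      ← ENNReal.ofReal_mul hγ.le] at hres
    have hlin' : ‖f x - f xb - σ k x (x - xb)‖ ≤ η * ‖x - xb‖ :=
      (ENNReal.ofReal_le_ofReal_iff (by positivity)).1
        ((le_iSup₂ (f := fun (A : X →L[ℝ] Y) (_ : A ∈ H x) =>
          ENNReal.ofReal ‖f x - f xb - A (x - xb)‖) _ hA).trans hlin.le)
    obtain ⟨r₀, hr₀, hr₀x⟩ := Metric.infEDist_lt_iff.1
      ((le_iSup (fun k => Metric.infEDist (0 : Y) (R k (x, xb))) k).trans_lt hres)
    rw [edist_comm, edist_dist, dist_zero_right,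
      ENNReal.ofReal_lt_ofReal_iff_of_nonneg (norm_nonneg _)] at hr₀x
    obtain ⟨A₁, hA₁, E₁, hE₁, hAE⟩ := Set.mem_add.1 (hHx hA)
    obtain ⟨B, hB, E₂, hE₂, hBE⟩ := Set.mem_add.1 (h𝓕 hA₁)
    rw [mem_closedBall_zero_iff] at hE₁ hE₂
    have hAB : ‖σ k x - B‖ ≤ ρ := by
      have h : σ k x - B = E₂ + E₁ := by rw [← hAE, ← hBE]; abel
      rw [h]
      exact (norm_add_le _ _).trans (add_le_add hE₂ hE₁)
    exact SetMap.exists_isNewtonStep hF hsol (hR_closed k) hl.le hδa hδa' hη.le ht0.le ht1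
      (by linarith) htm hδ (hδopen B hB) hAB hxδ hxc hlin' hr₀ hr₀x.le
      fun u hu u' hu' => hR_aubin x (by rw [mem_ball_iff_norm]; linarith) u hu u' hu' k
  obtain ⟨x, hx0, hxball, hxstep⟩ := SetMap.exists_seq_of_forall_exists
    (P := fun _ x => x ∈ Metric.ball xb r) (Q := fun k x x' => σ k x ∈ H x ∧
      SetMap.IsNewtonStep f F (R k) (σ k x) x x' ∧ ‖x' - xb‖ ≤ t * ‖x - xb‖) x₀ hx₀ hstep
  refine ⟨x, hx0, fun k => ⟨hxball k, hxstep k⟩, ?_⟩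
  have hgeo : ∀ k, ‖x k - xb‖ ≤ t ^ k * ‖x 0 - xb‖ := by
    intro k
    induction k with
    | zero => simp
    | succ k ih =>
      calc ‖x (k + 1) - xb‖ ≤ t * ‖x k - xb‖ := (hxstep k).2.2
        _ ≤ t * (t ^ k * ‖x 0 - xb‖) := by gcongr
        _ = t ^ (k + 1) * ‖x 0 - xb‖ := by ring
  have hlim := (tendsto_pow_atTop_nhds_zero_of_lt_one ht0.le ht1).mul_const ‖x 0 - xb‖
  rw [zero_mul] at hlim
  exact tendsto_iff_norm_sub_tendsto_zero.2
    (squeeze_zero (fun _ => norm_nonneg _) hgeo hlim)
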